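/- Let $m,n\ge 1$ be integers. Write $|\cdot|$ for the supremum norm, $\langle \mathbf y\rangle$ for the point of $[-1/2,1/2)^m$ congruent to $\mathbf y\in\mathbb R^m$ modulo $\mathbb Z^m$, $\|\mathbf y\|=|\langle\mathbf y\rangle|$, $\Pi(\mathbf y)=\prod_{j}|y_j|$ and $\Pi_+(\mathbf q)=\prod_{i}\max\{1,|q_i|\}$. For a real $m\times n$ matrix $\mathbf X$ and $\boldsymbol\theta\in\mathbb R^m$ let $\omega(\mathbf X,\boldsymbol\theta)\in[0,\infty]$ (respectively $\hat\omega(\mathbf X,\boldsymbol\theta)$) be the supremum of the $w\ge 0$ such that for arbitrarily large $Q>1$ (respectively for all sufficiently large $Q$) there is a nonzero $\mathbf q\in\mathbb Z^n$ with $$\|\mathbf X\mathbf q+\boldsymbol\theta\|<Q^{-w},\qquad |\mathbf q|\le Q,$$ and let $\omega^\times(\mathbf X,\boldsymbol\theta)\in[0,\infty]$ be the supremum of the $w\ge 0$ such that for arbitrarily large $Q>1$ there is a nonzero $\mathbf q\in\mathbb Z^n$ with $$\Pi\langle\mathbf X\mathbf q+\boldsymbol\theta\rangle<Q^{-mw},\qquad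 \Pi_+(\mathbf q)\le Q^n .$$ Put $\omega(\mathbf X)=\omega(\mathbf X,\mathbf 0)$, and similarly for $\hat\omega$ and $\omega^\times$ (and for the transposed matrix ${}^t\mathbf X$, which is $n\times m$). For $\mathbf a\in\mathbb R^n$ with $\|\mathbf a\|_2=1$, $\mathbf b\in\mathbb R^m$ and $\boldsymbol\varepsilon\in(0,\infty)^m$ let $$\mathcal L_{\mathbf a,\mathbf b}^{\boldsymbol\varepsilon}=\{\mathbf X\in\mathbb R^{m\times n}: |\mathbf X_j\mathbf a+b_j|<\varepsilon_j,\ 1\le j\le m\},$$ where $\mathbf X_j$ is the $j$-th row of $\mathbf X$. Let $cB$ denote the ball with the same centre as the ball $B$ and $c$ times its radius. A finite Borel measure $\mu$ on $\mathbb R^{m\times n}$, with support $S$, that is non-atomic (points have measure zero) and doubling ($\mu(2B)\le c\,\mu(B)$ for some constant $c>1$ and all balls $B$ centred in $S$) is called *strongly contracting* if there are $C,\alpha,r_0>0$ such that for all $\mathbf a,\mathbf b$ as above, all $\boldsymbol\varepsilon\in(0,\infty)^m$ with $\min_j\varepsilon_j<r_0$, all $\delta\in(0,1)$ and all $\mathbf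 X\in\mathcal L_{\mathbf a,\mathbf b}^{\delta\boldsymbol\varepsilon}\cap S$ there is an open ball $B$ centred at $\mathbf X$ with $$B\cap S\subset\mathcal L_{\mathbf a,\mathbf b}^{\boldsymbol\varepsilon}\quad\text{and}\quad \mu(5B\cap\mathcal L_{\mathbf a,\mathbf b}^{\delta\boldsymbol\varepsilon})\le C\delta^\alpha\mu(5B).$$ It is *contracting* if this holds for the $\boldsymbol\varepsilon$ with $\varepsilon_1=\dots=\varepsilon_m$. A Borel measure $\mu$ is (strongly) contracting *almost everywhere* if $\mu$-almost every point has a neighbourhood $U$ such that the restriction $\mu|_U$ is (strongly) contracting. **Theorem.** Let $\mu$ be a Borel measure on $\mathbb R^{m\times n}$. (A) Suppose that $\mu$ is contracting almost everywhere, and let $v\in\mathbb R$ be such that $\omega(\mathbf X)=v$ for $\mu$-almost every $\mathbf X$. Then for every $\boldsymbol\theta\in\mathbb R^m$ and $\mu$-almost every $\mathbf X$ $$\omega(\mathbf X,\boldsymbol\theta)\ \ge\ \begin{cases}\dfrac{v}{mv-n+1}&\text{if }\hat\omega({}^t\mathbf X)\le 1,\\[3mm] n-(m-1)v&\text{if }\hat\omega({}^t\mathbf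 X)\ge 1,\end{cases}$$ and the second case, $\hat\omega({}^t\mathbf X)\ge 1$, occurs whenever $m\ge n$. (B) Suppose that $\mu$ is strongly contracting almost everywhere, and let $v^\times\in\mathbb R$ be such that $\omega^\times(\mathbf X)=v^\times$ for $\mu$-almost every $\mathbf X$. Then for every $\boldsymbol\theta\in\mathbb R^m$ and $\mu$-almost every $\mathbf X$ $$\omega^\times(\mathbf X,\boldsymbol\theta)\ \ge\ \max\left(0,\ \frac{n-(m-1)v^\times}{mv^\times-n+1}\right).$$ -/

import Mathlib

open Filter Topology MeasureTheory
open scoped Matrix ENNReal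

/- The space of real `m × n` matrices carries the supremum norm. Replacing it by another norm
changes neither the Borel sets nor the classes of doubling, contracting and strongly contracting
measures below. -/
attribute [local instance] Matrix.normedAddCommGroup

/-- Real matrices carry their Borel σ-algebra. -/
instance matrixBorel (m n : ℕ) : MeasurableSpace (Matrix (Fin m) (Fin n) ℝ) := borel _

instance matrixBorelSpace (m n : ℕ) : BorelSpace (Matrix (Fin m) (Fin n) ℝ) := ⟨rfl⟩

noncomputable section

/-- `⟨y⟩`: the representative of `y ∈ ℝᵐ` modulo `ℤᵐ` in `[-1/2, 1/2)ᵐ`. -/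
def centredRep {m : ℕ} (y : Fin m → ℝ) : Fin m → ℝ := fun j => y j - (round (y j) : ℝ)

/-- `X q + θ` for an integer vector `q`. -/
def affineForm {m n : ℕ} (X : Matrix (Fin m) (Fin n) ℝ) (θ : Fin m → ℝ) (q : Fin n → ℤ) :
    Fin m → ℝ :=
  X *ᵥ (fun i => (q i : ℝ)) + θ

/-- Solvability of `‖X q + θ‖ < Q ^ (-w)`, `|q| ≤ Q` in nonzero integer vectors `q`
(supremum norms; `‖·‖` is the distance to the nearest integer point). -/
def ApproxSolvable {m n : ℕ} (X : Matrix (Fin m) (Fin n) ℝ) (θ : Fin m → ℝ) (w Q : ℝ) : Prop :=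
  ∃ q : Fin n → ℤ, q ≠ 0 ∧ ‖centredRep (affineForm X θ q)‖ < Q ^ (-w) ∧ ‖q‖ ≤ Q

/-- Solvability of `Π⟨X q + θ⟩ < Q ^ (-m w)`, `Π₊(q) ≤ Q ^ n` in nonzero integer vectors `q`. -/
def MulApproxSolvable {m n : ℕ} (X : Matrix (Fin m) (Fin n) ℝ) (θ : Fin m → ℝ) (w Q : ℝ) : Prop :=
  ∃ q : Fin n → ℤ, q ≠ 0 ∧
    ∏ j, |centredRep (affineForm X θ q) j| < Q ^ (-((m : ℝ) * w)) ∧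
    ∏ i, max 1 |(q i : ℝ)| ≤ Q ^ n

/-- The exponent `ω(X, θ) ∈ [0, ∞]`: supremum of the `w ≥ 0` for which the system is solvable for
arbitrarily large `Q`. -/
def omegaExp {m n : ℕ} (X : Matrix (Fin m) (Fin n) ℝ) (θ : Fin m → ℝ) : EReal :=
  sSup {e : EReal | ∃ w : ℝ, e = (w : EReal) ∧ 0 ≤ w ∧ ∃ᶠ Q : ℝ in atTop, ApproxSolvable X θ w Q}

/-- The uniform exponent `ω̂(X, θ) ∈ [0, ∞]`: the system has to be solvable for all sufficiently
large `Q`. -/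
def omegaHat {m n : ℕ} (X : Matrix (Fin m) (Fin n) ℝ) (θ : Fin m → ℝ) : EReal :=
  sSup {e : EReal | ∃ w : ℝ, e = (w : EReal) ∧ 0 ≤ w ∧ ∀ᶠ Q : ℝ in atTop, ApproxSolvable X θ w Q}

/-- The multiplicative exponent `ω^×(X, θ) ∈ [0, ∞]`. -/
def omegaMul {m n : ℕ} (X : Matrix (Fin m) (Fin n) ℝ) (θ : Fin m → ℝ) : EReal :=
  sSup {e : EReal | ∃ w : ℝ, e = (w : EReal) ∧ 0 ≤ w ∧
    ∃ᶠ Q : ℝ in atTop, MulApproxSolvable X θ w Q}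

/-- A measure is doubling if `μ(2B) ≤ c μ(B)` for all balls `B` centred in its support. -/
def IsDoublingOnSupport {m n : ℕ} (μ : Measure (Matrix (Fin m) (Fin n) ℝ)) : Prop :=
  ∃ c : ℝ, 1 < c ∧ ∀ X ∈ μ.support, ∀ r : ℝ, 0 < r →
    μ (Metric.ball X (2 * r)) ≤ ENNReal.ofReal c * μ (Metric.ball X r)

/-- The `ε`-neighbourhood `{X : |X_j a + b_j| < ε_j for all j}` of the plane `{X : X a + b = 0}`. -/
def planeNhd {m n : ℕ} (a : Fin n → ℝ) (b ε : Fin m → ℝ) : Set (Matrix (Fin m) (Fin n) ℝ) :=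
  {X | ∀ j, |(X *ᵥ a + b) j| < ε j}

/-- The requirement common to contracting and strongly contracting measures: non-atomic, finite,
doubling, and satisfying the contraction condition for those `ε` that lie in `E`. -/
def ContractsAlong {m n : ℕ} (E : Set (Fin m → ℝ)) (μ : Measure (Matrix (Fin m) (Fin n) ℝ)) :
    Prop :=
  (∀ X, μ {X} = 0) ∧ IsFiniteMeasure μ ∧ IsDoublingOnSupport μ ∧
  ∃ C α r₀ : ℝ, 0 < C ∧ 0 < α ∧ 0 < r₀ ∧
    ∀ (a : Fin n → ℝ) (b : Fin m → ℝ), ∑ i, a i ^ 2 = 1 →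
    ∀ ε ∈ E, (∀ j, 0 < ε j) → (∃ j, ε j < r₀) →
    ∀ δ : ℝ, 0 < δ → δ < 1 →
    ∀ X ∈ planeNhd a b (δ • ε) ∩ μ.support, ∃ r : ℝ, 0 < r ∧
      Metric.ball X r ∩ μ.support ⊆ planeNhd a b ε ∧
      μ (Metric.ball X (5 * r) ∩ planeNhd a b (δ • ε)) ≤
        ENNReal.ofReal (C * δ ^ α) * μ (Metric.ball X (5 * r))

/-- Strongly contracting measures: all `ε = (ε_1, …, ε_m)` are admitted. -/
def IsStronglyContracting {m n : ℕ} (μ : Measure (Matrix (Fin m) (Fin n) ℝ)) : Prop :=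
  ContractsAlong Set.univ μ

/-- Contracting measures: only `ε` with `ε_1 = ⋯ = ε_m` are admitted. -/
def IsContracting {m n : ℕ} (μ : Measure (Matrix (Fin m) (Fin n) ℝ)) : Prop :=
  ContractsAlong {ε | ∀ j k, ε j = ε k} μ

/-- `μ`-almost every point has a neighbourhood `U` such that `μ|_U` is contracting. -/
def IsContractingAE {m n : ℕ} (μ : Measure (Matrix (Fin m) (Fin n) ℝ)) : Prop :=
  ∀ᵐ X ∂μ, ∃ U ∈ 𝓝 X, MeasurableSet U ∧ IsContracting (μ.restrict U)

/-- `μ`-almost every point has a neighbourhood `U` such that `μ|_U` is strongly contracting. -/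
def IsStronglyContractingAE {m n : ℕ} (μ : Measure (Matrix (Fin m) (Fin n) ℝ)) : Prop :=
  ∀ᵐ X ∂μ, ∃ U ∈ 𝓝 X, MeasurableSet U ∧ IsStronglyContracting (μ.restrict U)

end

/-! The bounds are proved for each individual `X`, by comparing `ω(X, θ)` and `ω(X) = v` with the
uniform exponent `ω̂(ᵗX)`.

The first comparison is `ω(X, θ) ≥ 1 / ω̂(ᵗX)`, an effective Kronecker theorem. If at some scale `T`
no small dual vector `y` makes `ᵗX y` nearly integral, a double exponential sum over dual vectors
and over `q` shows that `X q + θ` comes close to an integer point (`exists_inhomogeneous_approx`,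
`frequently_exists_inhomogeneous_approx`).

The second comparison bounds `ω̂(ᵗX)` from above in terms of `v`. For `h < ω̂(ᵗX)` there are
consecutive minimal points `y₁, y₂` of `ᵗX` at arbitrarily large height. Both pair integrally with
the lattice of the vectors `(q, X q + p)`, and the 2 × 2 minors of the pair are small, so
Minkowski's theorem gives a short lattice vector orthogonal to both (`exists_approx_of_minors`).
This vector is a good approximation for `X`, and optimising the scale yields `(n - m v)(1 + h) ≤ 2
(1 - h v)` (`mul_le_of_lt_omegaHat_transpose`). Since `n ≤ m v` by Dirichlet, replacing `1 + h` by
`2` or by `2 h` gives the two cases `h ≤ 1` and `h ≥ 1`.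

The multiplicative bound follows from `ω ≤ ω^×`, used for `θ` and for `0`, and the monotonicity in
`v` of the bounds involved. -/

/-! ### Minkowski's convex body theorem for linear forms. -/

/-- Minkowski's theorem on linear forms. -/
theorem exists_int_ne_zero_abs_mulVec_lt {ι : Type*} [Fintype ι] [DecidableEq ι]
    (A : Matrix ι ι ℝ) (c : ι → ℝ) (hc : ∀ l, 0 < c l) (hA : A.det ≠ 0)
    (h : |A.det| < ∏ l, c l) :
    ∃ x : ι → ℤ, x ≠ 0 ∧ ∀ l, |(A *ᵥ (fun i => (x i : ℝ))) l| < c l := by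
  have fund := ZSpan.isAddFundamentalDomain' (Pi.basisFun ℝ ι) (volume : Measure (ι → ℝ))
  set s : Set (ι → ℝ) :=
    (Matrix.toLin' A) ⁻¹' (Set.pi Set.univ fun l => Set.Ioo (-c l) (c l)) with hs
  have hdet : LinearMap.det (Matrix.toLin' A) = A.det := LinearMap.det_toLin' A
  have hvol : volume s = ENNReal.ofReal (|A.det|⁻¹ * ∏ l, (2 * c l)) := by
    rw [hs, Measure.addHaar_preimage_linearMap volume (by rwa [hdet]), hdet, volume_pi_pi,
      ENNReal.ofReal_mul (by positivity), abs_inv,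
      ENNReal.ofReal_prod_of_nonneg (fun l _ => by have := hc l; positivity)]
    congr 1
    refine Finset.prod_congr rfl fun l _ => ?_
    rw [Real.volume_Ioo]
    congr 1
    ring
  have hsymm : ∀ x ∈ s, -x ∈ s := by
    intro x hx
    simp only [hs, Set.mem_preimage, Set.mem_pi, Set.mem_univ, forall_const, Set.mem_Ioo,
      map_neg, Pi.neg_apply] at hx ⊢
    intro l
    constructor <;> linarith [(hx l).1, (hx l).2]
  have hconv : Convex ℝ s :=
    (convex_pi fun l _ => convex_Ioo (-c l) (c l)).linear_preimage (Matrix.toLin' A)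
  have hlt : volume (ZSpan.fundamentalDomain (Pi.basisFun ℝ ι)) * 2 ^ Module.finrank ℝ (ι → ℝ)
      < volume s := by
    have h1 : volume (ZSpan.fundamentalDomain (Pi.basisFun ℝ ι)) = 1 := by
      rw [ZSpan.fundamentalDomain_pi_basisFun, volume_pi_pi]
      simp
    rw [h1, one_mul, hvol, Module.finrank_fintype_fun_eq_card, Finset.prod_mul_distrib,
      Finset.prod_const, Finset.card_univ]
    have h2 : (2 : ℝ≥0∞) ^ Fintype.card ι = ENNReal.ofReal (2 ^ Fintype.card ι) := by
      rw [ENNReal.ofReal_pow (by norm_num)]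
      simp
    rw [h2, ENNReal.ofReal_lt_ofReal_iff_of_nonneg (by positivity)]
    have h3 : 0 < |A.det| := abs_pos.2 hA
    rw [inv_mul_eq_div, lt_div_iff₀ h3]
    gcongr
  have : Countable (Submodule.span ℤ (Set.range (Pi.basisFun ℝ ι))).toAddSubgroup :=
    inferInstanceAs (Countable (Submodule.span ℤ (Set.range (Pi.basisFun ℝ ι))))
  obtain ⟨⟨x, hxL⟩, hx0, hxs⟩ :=
    exists_ne_zero_mem_lattice_of_measure_mul_two_pow_lt_measure fund hsymm hconv hlt
  have hint : ∀ i, ∃ z : ℤ, (z : ℝ) = x i := by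
    have := ((Pi.basisFun ℝ ι).mem_span_iff_repr_mem ℤ x).1 hxL
    intro i
    simpa using this i
  choose z hz using hint
  have hzx : (fun i => (z i : ℝ)) = x := funext hz
  refine ⟨z, ?_, ?_⟩
  · rintro rfl
    apply hx0
    ext i
    simp [← hz i]
  · intro l
    rw [hzx, abs_lt]
    have := hxs l (Set.mem_univ l)
    simpa using this

/-! ### Lattice points in the kernel of integral forms with small minors. -/

section Minors

variable {ι : Type*} [Fintype ι] [DecidableEq ι] {k : ℕ}

/-- The identity matrix with the rows indexed by `e` replaced by the rows of `Z`. -/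
def replaceRows (Z : Matrix (Fin k) ι ℝ) (e : Fin k → ι) : Matrix ι ι ℝ :=
  1 + (1 : Matrix ι ι ℝ).submatrix id e * (Z - (1 : Matrix ι ι ℝ).submatrix e id)

/-- The identity `det (1 + U V) = det (1 + V U)` reduces the large determinant to a `k × k` one;
there the identity cancels because the selection matrix of an injective `e` has orthonormal columns.
-/
theorem det_replaceRows (Z : Matrix (Fin k) ι ℝ) {e : Fin k → ι} (he : Function.Injective e) :
    (replaceRows Z e).det = (Z.submatrix id e).det := by
  rw [replaceRows, Matrix.det_one_add_mul_comm, Matrix.sub_mul]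
  congr 1
  have h1 : Z * (1 : Matrix ι ι ℝ).submatrix id e = Z.submatrix id e := by
    ext a b
    simp [Matrix.mul_apply, Matrix.one_apply]
  have h2 : (1 : Matrix ι ι ℝ).submatrix e id * (1 : Matrix ι ι ℝ).submatrix id e = 1 := by
    ext a b
    simp [Matrix.mul_apply, Matrix.one_apply, he.eq_iff]
  rw [h1, h2]
  abel

theorem replaceRows_mulVec_of_notMem (Z : Matrix (Fin k) ι ℝ) {e : Fin k → ι} (w : ι → ℝ)
    {l : ι} (hl : l ∉ Set.range e) : (replaceRows Z e *ᵥ w) l = w l := by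
  have h : ∀ b, e b ≠ l := fun b hb => hl ⟨b, hb⟩
  rw [replaceRows, Matrix.add_mulVec, Matrix.one_mulVec, ← Matrix.mulVec_mulVec, Pi.add_apply,
    add_eq_left]
  simp [Matrix.mulVec, dotProduct, Matrix.one_apply, fun b => (h b).symm]

theorem replaceRows_mulVec_apply (Z : Matrix (Fin k) ι ℝ) {e : Fin k → ι}
    (he : Function.Injective e) (w : ι → ℝ) (b : Fin k) :
    (replaceRows Z e *ᵥ w) (e b) = (Z *ᵥ w) b := by
  have h1 : ∀ u : Fin k → ℝ, ((1 : Matrix ι ι ℝ).submatrix id e *ᵥ u) (e b) = u b := by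
    intro u
    simp [Matrix.mulVec, dotProduct, Matrix.one_apply, he.eq_iff]
  have h2 : ((1 : Matrix ι ι ℝ).submatrix e id *ᵥ w) b = w (e b) := by
    simp [Matrix.mulVec, dotProduct, Matrix.one_apply]
  rw [replaceRows, Matrix.add_mulVec, Matrix.one_mulVec, ← Matrix.mulVec_mulVec, Pi.add_apply,
    h1, Matrix.sub_mulVec, Pi.sub_apply, h2]
  ring

/-- A vector annihilated by the rows of `Z` is controlled by its coordinates off a set of columns
that carries a minor of `Z` of maximal size. -/
theorem abs_apply_lt_one_of_mulVec_eq_zero (Z : Matrix (Fin k) ι ℝ) {e : Fin k → ι}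
    (hne : (Z.submatrix id e).det ≠ 0)
    (hmax : ∀ f : Fin k → ι, |(Z.submatrix id f).det| ≤ |(Z.submatrix id e).det|)
    {w : ι → ℝ} (hw : Z *ᵥ w = 0)
    (hsmall : ∀ l ∉ Set.range e, |w l| < 1 / (Fintype.card ι + 1)) (b : Fin k) :
    |w (e b)| < 1 := by
  set M := Z.submatrix id e with hM
  have hcol : ∀ l, Matrix.cramer M (fun a => Z a l) b
      = (Z.submatrix id (Function.update e b l)).det := by
    intro l
    rw [Matrix.cramer_apply]
    congr 1
    ext i j
    by_cases hj : j = b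
    · subst hj; simp
    · simp [hM, hj]
  -- Cramer's rule applied to `Z w = 0`, expanded over the columns of `Z`. The coefficient of `w (e
  -- b)` is the maximal minor itself.
  have hsum : ∑ l, w l * (Z.submatrix id (Function.update e b l)).det = 0 := by
    have h0 : Matrix.cramer M (Z *ᵥ w) b = 0 := by rw [hw]; simp
    have h1 : Z *ᵥ w = ∑ l, w l • (fun a => Z a l) := by
      ext a
      simp [Matrix.mulVec, dotProduct, mul_comm]
    rw [h1, map_sum, Finset.sum_apply] at h0
    simpa [hcol] using h0
  rw [← Finset.add_sum_erase _ _ (Finset.mem_univ (e b)), Function.update_eq_self, ← hM] at hsum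
  have hpos : 0 < |M.det| := abs_pos.2 hne
  have hbound : |∑ l ∈ Finset.univ.erase (e b), w l * (Z.submatrix id (Function.update e b l)).det|
      ≤ ∑ l ∈ Finset.univ.erase (e b), 1 / (Fintype.card ι + 1) * |M.det| := by
    refine (Finset.abs_sum_le_sum_abs _ _).trans (Finset.sum_le_sum fun l hl => ?_)
    have hlb := Finset.ne_of_mem_erase hl
    rw [abs_mul]
    -- A column already selected at another place gives a minor with two equal columns, so only
    -- coordinates off the range of `e` contribute.
    by_cases hr : l ∈ Set.range e
    · obtain ⟨b', rfl⟩ := hr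
      have hbb : b ≠ b' := fun h => hlb (by rw [h])
      rw [Matrix.det_zero_of_column_eq hbb (fun i => by
        simp [Function.update_of_ne hbb.symm])]
      simp only [abs_zero, mul_zero]
      positivity
    · exact mul_le_mul (hsmall l hr).le (hmax _) (abs_nonneg _) (by positivity)
  rw [Finset.sum_const, nsmul_eq_mul] at hbound
  have hcard : ((Finset.univ.erase (e b)).card : ℝ) ≤ Fintype.card ι := by
    exact_mod_cast Finset.card_le_univ _
  have h1 : |w (e b)| * |M.det| ≤ Fintype.card ι * (1 / (Fintype.card ι + 1) * |M.det|) := by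
    rw [← abs_mul, eq_neg_of_add_eq_zero_left hsum, abs_neg]
    exact hbound.trans (by gcongr)
  have h2 : (Fintype.card ι : ℝ) * (1 / (Fintype.card ι + 1) * |M.det|) < 1 * |M.det| := by
    rw [← mul_assoc]
    refine mul_lt_mul_of_pos_right ?_ hpos
    rw [mul_one_div, div_lt_one (by positivity)]
    linarith
  exact lt_of_mul_lt_mul_right (h1.trans_lt h2) hpos.le

/-- If the minors of `Z` are small in terms of `det A`, and `Z` takes integer values on the
lattice `A ℤ^ι`, then some nonzero vector of this lattice lies in the unit cube and in the kernel
of `Z`. -/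
theorem exists_int_ne_zero_abs_mulVec_lt_one (A : Matrix ι ι ℝ) (hA : A.det ≠ 0)
    (Z : Matrix (Fin k) ι ℝ)
    (hZ : ∀ (x : ι → ℤ) (a : Fin k), ∃ z : ℤ, (Z *ᵥ (A *ᵥ fun i => (x i : ℝ))) a = z)
    {Δ : ℝ} (hΔ : ∀ f : Fin k → ι, |(Z.submatrix id f).det| ≤ Δ)
    (hne : ∃ f : Fin k → ι, (Z.submatrix id f).det ≠ 0)
    (h : Δ * |A.det| * (Fintype.card ι + 1) ^ Fintype.card ι < 1) :
    ∃ x : ι → ℤ, x ≠ 0 ∧ ∀ l, |(A *ᵥ (fun i => (x i : ℝ))) l| < 1 := by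
  obtain ⟨f, hf⟩ := hne
  have : Nonempty (Fin k → ι) := ⟨f⟩
  obtain ⟨e, hmax⟩ := Finite.exists_max fun e : Fin k → ι => |(Z.submatrix id e).det|
  have hne : (Z.submatrix id e).det ≠ 0 :=
    abs_pos.1 ((abs_pos.2 hf).trans_le (hmax f))
  have he : Function.Injective e := by
    intro a b hab
    by_contra hne'
    exact hne (Matrix.det_zero_of_column_eq hne' fun i => by simp [hab])
  classical
  set t : ℝ := 1 / (Fintype.card ι + 1) with ht
  have ht0 : 0 < t := by positivity
  have ht1 : t ≤ 1 := by
    rw [ht, div_le_one (by positivity)]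
    linarith [(Nat.cast_nonneg (Fintype.card ι) : (0 : ℝ) ≤ _)]
  -- The rows of `Z` need only the bound 1, since they take integer values. The other coordinates
  -- get the bound `t = 1 / (card ι + 1)`, small enough for the Cramer estimate to control the
  -- coordinates in the range of `e`.
  obtain ⟨x, hx0, hx⟩ := exists_int_ne_zero_abs_mulVec_lt (replaceRows Z e * A)
    (fun l => if l ∈ Set.range e then 1 else t) (fun l => by split_ifs <;> positivity)
    (by rw [Matrix.det_mul, det_replaceRows Z he]; exact mul_ne_zero hne hA) (by
      rw [Matrix.det_mul, det_replaceRows Z he, abs_mul]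
      have h1 : t ^ Fintype.card ι ≤ ∏ l, (if l ∈ Set.range e then 1 else t) := by
        rw [← Finset.card_univ, ← Finset.prod_const]
        refine Finset.prod_le_prod (fun _ _ => ht0.le) fun l _ => ?_
        split_ifs <;> linarith
      refine lt_of_lt_of_le ?_ h1
      rw [ht, one_div, inv_pow, ← one_div, lt_div_iff₀ (by positivity)]
      refine lt_of_le_of_lt ?_ h
      gcongr
      exact hΔ e)
  refine ⟨x, hx0, ?_⟩
  set w := A *ᵥ fun i => (x i : ℝ) with hw
  rw [← Matrix.mulVec_mulVec, ← hw] at hx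
  have hZw : Z *ᵥ w = 0 := by
    ext a
    obtain ⟨z, hz⟩ := hZ x a
    have h1 := hx (e a)
    rw [replaceRows_mulVec_apply Z he, if_pos ⟨a, rfl⟩, hz] at h1
    rw [hz, Pi.zero_apply, Int.cast_eq_zero]
    exact Int.abs_lt_one_iff.1 (by exact_mod_cast h1)
  have hsmall : ∀ l ∉ Set.range e, |w l| < t := by
    intro l hl
    have h1 := hx l
    rwa [replaceRows_mulVec_of_notMem Z w hl, if_neg hl] at h1
  intro l
  by_cases hl : l ∈ Set.range e
  · obtain ⟨b, rfl⟩ := hl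
    exact abs_apply_lt_one_of_mulVec_eq_zero Z hne hmax hZw hsmall b
  · exact (hsmall l hl).trans_le ht1

end Minors

/-- Short integer vectors orthogonal to given dual approximations `y_a`: if the `k × k` minors of
the rows `(Q ⟨ᵗX y_a⟩, ε y_a)` are small compared to `Q ^ n * ε ^ m`, then
`|q| ≤ Q`, `‖X q‖ < ε` has a nonzero solution. -/
theorem exists_approx_of_minors {m n k : ℕ} (X : Matrix (Fin m) (Fin n) ℝ)
    (y : Fin k → Fin m → ℤ) {Q ε Δ : ℝ} (hQ : 0 < Q) (hε : 0 < ε) (hε1 : ε ≤ 1)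
    (hΔ : ∀ f : Fin k → Fin n ⊕ Fin m, |(Matrix.of fun a b =>
      Sum.elim (fun i => Q * centredRep (affineForm Xᵀ 0 (y a)) i)
        (fun j => ε * (y a j : ℝ)) (f b)).det| ≤ Δ)
    (hne : ∃ f : Fin k → Fin n ⊕ Fin m, (Matrix.of fun a b =>
      Sum.elim (fun i => Q * centredRep (affineForm Xᵀ 0 (y a)) i)
        (fun j => ε * (y a j : ℝ)) (f b)).det ≠ 0)
    (h : Δ * (n + m + 1) ^ (n + m) < Q ^ n * ε ^ m) :
    ∃ q : Fin n → ℤ, q ≠ 0 ∧ ‖centredRep (affineForm X 0 q)‖ < ε ∧ ‖q‖ ≤ Q := by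
  -- The lattice of vectors `(q / Q, -(X q + p) / ε)`. The sign makes the terms `ᵗX y · q` and `y ·
  -- X q` cancel in the pairing with a row of `Z`, which leaves an integer.
  set A : Matrix (Fin n ⊕ Fin m) (Fin n ⊕ Fin m) ℝ :=
    Matrix.fromBlocks (Q⁻¹ • 1) 0 (-ε⁻¹ • X) (-ε⁻¹ • 1) with hA
  have hdet : |A.det| = (Q ^ n * ε ^ m)⁻¹ := by
    rw [hA, Matrix.det_fromBlocks_zero₁₂, Matrix.det_smul, Matrix.det_smul]
    simp [abs_mul, abs_of_pos hQ, abs_of_pos hε, mul_comm]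
  have hinl : ∀ (x : Fin n ⊕ Fin m → ℤ) (i : Fin n),
      (A *ᵥ fun l => (x l : ℝ)) (Sum.inl i) = Q⁻¹ * x (Sum.inl i) := by
    intro x i
    simp [hA, Matrix.mulVec, dotProduct, Matrix.one_apply]
  have hinr : ∀ (x : Fin n ⊕ Fin m → ℤ) (j : Fin m),
      (A *ᵥ fun l => (x l : ℝ)) (Sum.inr j)
        = -ε⁻¹ * (affineForm X 0 (fun i => x (Sum.inl i)) j + x (Sum.inr j)) := by
    intro x j
    simp [hA, affineForm, Matrix.mulVec, dotProduct, Matrix.one_apply, Finset.mul_sum, mul_add,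
      mul_assoc]
  set Z : Matrix (Fin k) (Fin n ⊕ Fin m) ℝ := Matrix.of fun a =>
    Sum.elim (fun i => Q * centredRep (affineForm Xᵀ 0 (y a)) i) (fun j => ε * (y a j : ℝ))
    with hZdef
  have hZ : ∀ (x : Fin n ⊕ Fin m → ℤ) (a : Fin k),
      ∃ z : ℤ, (Z *ᵥ (A *ᵥ fun i => (x i : ℝ))) a = z := by
    intro x a
    refine ⟨-(∑ i, round (affineForm Xᵀ 0 (y a) i) * x (Sum.inl i) + ∑ j, y a j * x (Sum.inr j)),
      ?_⟩
    have hswap : ∑ i, affineForm Xᵀ 0 (y a) i * (x (Sum.inl i) : ℝ)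
        = ∑ j, (y a j : ℝ) * affineForm X 0 (fun i => x (Sum.inl i)) j := by
      simp only [affineForm, Matrix.mulVec, dotProduct, add_zero, Finset.sum_mul, Finset.mul_sum,
        Matrix.transpose_apply]
      rw [Finset.sum_comm]
      exact Finset.sum_congr rfl fun j _ => Finset.sum_congr rfl fun i _ => by ring
    have h1 : (Z *ᵥ (A *ᵥ fun i => (x i : ℝ))) a
        = ∑ i, centredRep (affineForm Xᵀ 0 (y a)) i * (x (Sum.inl i) : ℝ)
          - ∑ j, (y a j : ℝ) * (affineForm X 0 (fun i => x (Sum.inl i)) j + x (Sum.inr j)) := by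
      rw [Matrix.mulVec, dotProduct, Fintype.sum_sum_type, sub_eq_add_neg, ← Finset.sum_neg_distrib]
      congr 1
      · refine Finset.sum_congr rfl fun i _ => ?_
        rw [hinl]
        simp only [hZdef, Matrix.of_apply, Sum.elim_inl]
        field_simp
      · refine Finset.sum_congr rfl fun j _ => ?_
        rw [hinr]
        simp only [hZdef, Matrix.of_apply, Sum.elim_inr]
        field_simp
    rw [h1]
    simp only [centredRep, sub_mul, mul_add, Finset.sum_sub_distrib, Finset.sum_add_distrib, hswap]
    push_cast
    ring
  obtain ⟨x, hx0, hx⟩ := exists_int_ne_zero_abs_mulVec_lt_one A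
    (abs_pos.1 (by rw [hdet]; positivity)) Z hZ hΔ hne (by
      rw [hdet, mul_right_comm, ← div_eq_mul_inv, div_lt_one (by positivity)]
      simpa using h)
  have hr : ∀ j, |affineForm X 0 (fun i => x (Sum.inl i)) j + x (Sum.inr j)| < ε := by
    intro j
    have h1 := hx (Sum.inr j)
    rwa [hinr, abs_mul, abs_neg, abs_of_pos (inv_pos.2 hε), inv_mul_eq_div, div_lt_one hε] at h1
  refine ⟨fun i => x (Sum.inl i), ?_, ?_, ?_⟩
  -- If `q = 0`, then `|p| < ε ≤ 1` forces `p = 0`, so the whole lattice vector vanishes.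
  · intro h0
    have h0' : ∀ i, x (Sum.inl i) = 0 := fun i => congrFun h0 i
    apply hx0
    ext l
    rcases l with i | j
    · exact h0' i
    · have h1 := (hr j).trans_le hε1
      have h2 : affineForm X 0 (fun i => x (Sum.inl i)) j = 0 := by
        simp [affineForm, h0', Matrix.mulVec, dotProduct]
      rw [h2, zero_add] at h1
      exact Int.abs_lt_one_iff.1 (by exact_mod_cast h1)
  · rw [pi_norm_lt_iff hε]
    intro j
    have h1 := round_le (affineForm X 0 (fun i => x (Sum.inl i)) j) (-x (Sum.inr j))
    push_cast at h1
    rw [sub_neg_eq_add] at h1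
    exact h1.trans_lt (hr j)
  · rw [pi_norm_le_iff_of_nonneg hQ.le]
    intro i
    have h1 := hx (Sum.inl i)
    rw [hinl, abs_mul, abs_of_pos (inv_pos.2 hQ), inv_mul_eq_div, div_lt_one hQ] at h1
    rw [Int.norm_eq_abs]
    exact h1.le

/-! ### Exponential sums and inhomogeneous transference. -/

/-- The character `x ↦ exp (2πix)`. -/
noncomputable def unitChar (x : ℝ) : ℂ := Complex.exp ((2 * Real.pi * x : ℝ) * Complex.I)

theorem norm_unitChar (x : ℝ) : ‖unitChar x‖ = 1 := Complex.norm_exp_ofReal_mul_I _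

theorem unitChar_add (x y : ℝ) : unitChar (x + y) = unitChar x * unitChar y := by
  rw [unitChar, unitChar, unitChar, ← Complex.exp_add]
  congr 1
  push_cast
  ring

theorem unitChar_zero : unitChar 0 = 1 := by simp [unitChar]

theorem unitChar_sum {ι : Type*} (s : Finset ι) (f : ι → ℝ) :
    unitChar (∑ i ∈ s, f i) = ∏ i ∈ s, unitChar (f i) := by
  classical
  induction s using Finset.induction_on with
  | empty => simp [unitChar_zero]
  | insert a s ha ih => rw [Finset.sum_insert ha, Finset.prod_insert ha, unitChar_add, ih]

theorem unitChar_natCast_mul (t : ℕ) (x : ℝ) : unitChar (t * x) = unitChar x ^ t := by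
  rw [unitChar, unitChar, ← Complex.exp_nat_mul]
  congr 1
  push_cast
  ring

/-- The chord has length `2 |sin (π z)|` with `|z| ≤ 1/2`, and Jordan's inequality bounds the sine
below by `2 |z|`. -/
theorem four_mul_abs_sub_round_le_norm_unitChar_sub_one (x : ℝ) :
    4 * |x - round x| ≤ ‖unitChar x - 1‖ := by
  set z := x - round x with hz
  have hx : unitChar x = unitChar z := by
    rw [unitChar, unitChar, Complex.exp_eq_exp_iff_exists_int]
    refine ⟨round x, ?_⟩
    rw [hz]
    push_cast
    ring
  have h1 : ‖unitChar z - 1‖ = 2 * |Real.sin (Real.pi * z)| := by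
    rw [unitChar, mul_comm, Complex.norm_exp_I_mul_ofReal_sub_one, Real.norm_eq_abs, abs_mul,
      abs_two]
    congr 3
    ring
  have h2 : |Real.pi * z| ≤ Real.pi / 2 := by
    rw [abs_mul, abs_of_pos Real.pi_pos]
    have := abs_sub_round x
    rw [← hz] at this
    nlinarith [Real.pi_pos]
  have h3 := Real.mul_abs_le_abs_sin h2
  rw [abs_mul, abs_of_pos Real.pi_pos, ← mul_assoc, div_mul_cancel₀ _ Real.pi_ne_zero] at h3
  rw [hx, h1]
  linarith

theorem norm_sum_unitChar_le {M : ℕ} {x η : ℝ} (hη : 0 < η) (hx : η ≤ |x - round x|) :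
    ‖∑ t : Fin M, unitChar (t * x)‖ ≤ 1 / (2 * η) := by
  have h1 := geom_sum_mul (unitChar x) M
  have h2 := four_mul_abs_sub_round_le_norm_unitChar_sub_one x
  have h3 : ‖∑ t : Fin M, unitChar (t * x)‖ * ‖unitChar x - 1‖ ≤ 2 := by
    rw [Fin.sum_univ_eq_sum_range (fun t => unitChar ((t : ℝ) * x)) M, ← norm_mul]
    simp_rw [unitChar_natCast_mul]
    rw [h1]
    refine (norm_sub_le _ _).trans ?_
    rw [norm_pow, norm_unitChar, one_pow, norm_one]
    norm_num
  rw [le_div_iff₀ (by positivity)]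
  nlinarith [norm_nonneg (∑ t : Fin M, unitChar (t * x))]

/-- The coordinatewise sums of a `p`-tuple of vectors with coordinates in `{0, …, M - 1}`. -/
def tupleSum {p m M : ℕ} (a : Fin p × Fin m → Fin M) (j : Fin m) : ℤ := ∑ s, ((a (s, j) : ℕ) : ℤ)

theorem tupleSum_mem_Ico {p m M : ℕ} (hp : 0 < p) (a : Fin p × Fin m → Fin M)
    (j : Fin m) : tupleSum a j ∈ Finset.Ico (0 : ℤ) (p * M) := by
  rw [Finset.mem_Ico]
  refine ⟨Finset.sum_nonneg fun s _ => by positivity, ?_⟩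
  have : Nonempty (Fin p) := ⟨⟨0, hp⟩⟩
  calc tupleSum a j < ∑ _s : Fin p, (M : ℤ) :=
        Finset.sum_lt_sum_of_nonempty Finset.univ_nonempty fun s _ => by
          exact_mod_cast (a (s, j)).2
    _ = p * M := by simp

theorem norm_tupleSum_le {p m M : ℕ} (hp : 0 < p) (a : Fin p × Fin m → Fin M) :
    ‖tupleSum a‖ ≤ p * M := by
  rw [pi_norm_le_iff_of_nonneg (by positivity)]
  intro j
  have h := Finset.mem_Ico.1 (tupleSum_mem_Ico hp a j)
  rw [Int.norm_eq_abs, abs_of_nonneg (by exact_mod_cast h.1)]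
  exact_mod_cast h.2.le

/-- The sum factors into the `p`-th power of a product of geometric sums, one for each coordinate; a
coordinate of `z` far from the integers saves a factor `2 M η`. Using `p`-tuples raises the saving
to the power `p`, which later absorbs the polynomial loss `(p M) ^ m`. -/
theorem norm_sum_unitChar_tupleSum_le {p m M : ℕ} (hM : 0 < M) {z : Fin m → ℝ} {η : ℝ}
    (hη : 0 < η) (hz : η ≤ ‖centredRep z‖) :
    ‖∑ a : Fin p × Fin m → Fin M, unitChar (∑ j, (tupleSum a j : ℝ) * z j)‖
      ≤ (Fintype.card (Fin p × Fin m → Fin M) : ℝ) * (1 / (2 * M * η)) ^ p := by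
  obtain ⟨j₀, hj₀⟩ : ∃ j, η ≤ |z j - round (z j)| := by
    by_contra! hcon
    exact absurd ((pi_norm_lt_iff hη).2 fun j => hcon j) (not_lt.2 hz)
  have h1 : ∑ a : Fin p × Fin m → Fin M, unitChar (∑ j, (tupleSum a j : ℝ) * z j)
      = ∏ i : Fin p × Fin m, ∑ t : Fin M, unitChar (t * z i.2) := by
    rw [Fintype.prod_sum]
    refine Finset.sum_congr rfl fun a _ => ?_
    rw [← unitChar_sum, Fintype.sum_prod_type_right]
    congr 1
    refine Finset.sum_congr rfl fun j _ => ?_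
    rw [tupleSum]
    push_cast
    rw [Finset.sum_mul]
  have hM' : (0 : ℝ) < M := by exact_mod_cast hM
  have h2 : ∀ j, ‖∑ t : Fin M, unitChar (t * z j)‖ ≤ M := by
    intro j
    refine (norm_sum_le _ _).trans ?_
    simp [norm_unitChar]
  have h3 : ‖∏ j, ∑ t : Fin M, unitChar (t * z j)‖ ≤ M ^ m * (1 / (2 * M * η)) := by
    rw [norm_prod, ← Finset.mul_prod_erase _ _ (Finset.mem_univ j₀)]
    have h4 : ∏ j ∈ Finset.univ.erase j₀, ‖∑ t : Fin M, unitChar (t * z j)‖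
        ≤ (M : ℝ) ^ (m - 1) := by
      refine (Finset.prod_le_prod (fun _ _ => norm_nonneg _) fun j _ => h2 j).trans ?_
      simp
    refine (mul_le_mul (norm_sum_unitChar_le hη hj₀) h4
      (Finset.prod_nonneg fun _ _ => norm_nonneg _) (by positivity)).trans (le_of_eq ?_)
    obtain ⟨m', rfl⟩ : ∃ m', m = m' + 1 := ⟨m - 1, by have := j₀.2; omega⟩
    rw [Nat.add_sub_cancel, pow_succ]
    field_simp
  simp only [h1, Fintype.prod_prod_type, Finset.prod_const, norm_pow]
  refine (pow_le_pow_left₀ (norm_nonneg _) h3 _).trans (le_of_eq ?_)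
  rw [mul_pow, Finset.card_univ, Fintype.card_fin]
  congr 1
  simp [← pow_mul, mul_comm]

/-- Quantitative inhomogeneous transference: if all small dual integer vectors are badly
approximable, then `‖X q + θ‖ < ε` has a solution of controlled size, for every `θ`. -/
theorem exists_inhomogeneous_approx {m n p M N : ℕ} (X : Matrix (Fin m) (Fin n) ℝ)
    (θ : Fin m → ℝ) (hp : 0 < p) (hM : 0 < M) (hN : 0 < N) {δ ε : ℝ} (hδ : 0 < δ) (hε : 0 < ε)
    (hdual : ∀ y : Fin m → ℤ, y ≠ 0 → ‖y‖ ≤ p * M → δ ≤ ‖centredRep (affineForm Xᵀ 0 y)‖)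
    (hlt : (1 / (2 * N * δ)) ^ p + (1 / (2 * M * ε)) ^ p < 1 / ((p : ℝ) * M) ^ m) :
    ∃ q : Fin n → ℤ, ‖centredRep (affineForm X θ q)‖ < ε ∧ ‖q‖ ≤ p * N := by
  classical
  by_contra! hcon
  set K : ℝ := (Fintype.card (Fin p × Fin m → Fin M) : ℝ) with hK
  set J : ℝ := (Fintype.card (Fin p × Fin n → Fin N) : ℝ) with hJ
  have : Nonempty (Fin M) := ⟨⟨0, hM⟩⟩
  have : Nonempty (Fin N) := ⟨⟨0, hN⟩⟩
  have hK0 : 0 < K := by rw [hK]; exact_mod_cast Fintype.card_pos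
  have hJ0 : 0 < J := by rw [hJ]; exact_mod_cast Fintype.card_pos
  have hp' : (0 : ℝ) < p := by exact_mod_cast hp
  have hM' : (0 : ℝ) < M := by exact_mod_cast hM
  set t : Finset (Fin m → ℤ) := Fintype.piFinset fun _ => Finset.Ico (0 : ℤ) (p * M) with ht
  have htcard : (t.card : ℝ) = ((p : ℝ) * M) ^ m := by
    rw [ht, Fintype.card_piFinset]
    simp only [Int.card_Ico, sub_zero, Finset.prod_const, Finset.card_univ, Fintype.card_fin]
    rw [show ((p : ℤ) * M).toNat = p * M by exact_mod_cast Int.toNat_natCast (p * M)]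
    push_cast
    rfl
  have hmaps : ∀ a ∈ (Finset.univ : Finset (Fin p × Fin m → Fin M)), tupleSum a ∈ t :=
    fun a _ => Fintype.mem_piFinset.2 fun j => tupleSum_mem_Ico hp a j
  have htne : t.Nonempty := by
    obtain ⟨a⟩ : Nonempty (Fin p × Fin m → Fin M) := inferInstance
    exact ⟨_, hmaps a (Finset.mem_univ a)⟩
  -- A popular value `y` of `tupleSum`: shifting by it creates a large diagonal contribution to the
  -- double sum of `g`.
  obtain ⟨y, hyt, hy⟩ := Finset.exists_le_card_fiber_of_nsmul_le_card_of_maps_to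
    (b := K / ((p : ℝ) * M) ^ m) hmaps htne (by
      rw [nsmul_eq_mul, htcard, mul_div_cancel₀ _ (by positivity), Finset.card_univ])
  set z : (Fin p × Fin n → Fin N) → Fin m → ℝ := fun b => affineForm X θ (tupleSum b) with hz
  set g : (Fin p × Fin m → Fin M) → (Fin p × Fin n → Fin N) → ℂ :=
    fun a b => unitChar (∑ j, ((tupleSum a j - y j : ℤ) : ℝ) * z b j) with hg
  -- Summing over `a` first: by `hcon` every `z b` is at distance at least `ε` from the integer
  -- points, so each inner sum is small.
  have hupper : ‖∑ a, ∑ b, g a b‖ ≤ J * (K * (1 / (2 * M * ε)) ^ p) := by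
    rw [Finset.sum_comm]
    refine (norm_sum_le _ _).trans ?_
    rw [hJ, ← Finset.card_univ, ← nsmul_eq_mul, ← Finset.sum_const]
    refine Finset.sum_le_sum fun b _ => ?_
    have h1 : ∀ a, g a b = unitChar (∑ j, (tupleSum a j : ℝ) * z b j)
        * unitChar (∑ j, -((y j : ℝ) * z b j)) := by
      intro a
      rw [← unitChar_add, ← Finset.sum_add_distrib]
      refine congrArg unitChar ?_
      refine Finset.sum_congr rfl fun j _ => ?_
      push_cast
      ring
    simp_rw [h1]
    rw [← Finset.sum_mul, norm_mul, norm_unitChar, mul_one]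
    refine norm_sum_unitChar_tupleSum_le hM hε ?_
    by_contra! hlt'
    exact absurd (norm_tupleSum_le hp b) (not_le.2 (hcon _ hlt'))
  have hfib : ∀ a, tupleSum a = y → ∑ b, g a b = J := by
    intro a ha
    have h1 : ∀ b, g a b = 1 := by
      intro b
      simp [hg, ha, unitChar_zero]
    simp [h1, hJ]
  -- Summing over `b` first: off the diagonal, `u = tupleSum a - y` is a nonzero dual vector of norm
  -- at most `p M`, so `hdual` applies. The shift `θ` contributes only a unimodular factor.
  have hoff : ∀ a, tupleSum a ≠ y → ‖∑ b, g a b‖ ≤ J * (1 / (2 * N * δ)) ^ p := by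
    intro a ha
    set u : Fin m → ℤ := tupleSum a - y with hu
    have hu0 : u ≠ 0 := sub_ne_zero.2 ha
    have hun : ‖u‖ ≤ p * M := by
      rw [pi_norm_le_iff_of_nonneg (by positivity)]
      intro j
      have h1 := Finset.mem_Ico.1 (tupleSum_mem_Ico hp a j)
      have h2 := Finset.mem_Ico.1 (Fintype.mem_piFinset.1 hyt j)
      have h3 : |u j| ≤ p * M := by
        rw [abs_le, hu, Pi.sub_apply]
        constructor <;> linarith
      rw [Int.norm_eq_abs]
      exact_mod_cast h3
    have h1 : ∀ b, g a b = unitChar (∑ j, (u j : ℝ) * θ j)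
        * unitChar (∑ i, (tupleSum b i : ℝ) * affineForm Xᵀ 0 u i) := by
      intro b
      rw [← unitChar_add]
      refine congrArg unitChar ?_
      have h2 : ∑ i, (tupleSum b i : ℝ) * affineForm Xᵀ 0 u i
          = ∑ j, (u j : ℝ) * (X *ᵥ fun i => (tupleSum b i : ℝ)) j := by
        simp only [affineForm, Matrix.mulVec, dotProduct, add_zero, Finset.mul_sum,
          Matrix.transpose_apply]
        rw [Finset.sum_comm]
        exact Finset.sum_congr rfl fun j _ => Finset.sum_congr rfl fun i _ => by ring
      rw [h2, ← Finset.sum_add_distrib]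
      refine Finset.sum_congr rfl fun j _ => ?_
      simp only [hz, affineForm, Pi.add_apply, hu, Pi.sub_apply]
      ring
    simp_rw [h1]
    rw [← Finset.mul_sum, norm_mul, norm_unitChar, one_mul]
    exact norm_sum_unitChar_tupleSum_le hN hδ (hdual u hu0 hun)
  have hsplit := Finset.sum_filter_add_sum_filter_not Finset.univ
    (fun a : Fin p × Fin m → Fin M => tupleSum a = y) (fun a => ∑ b, g a b)
  have hfirst : ‖∑ a with tupleSum a = y, ∑ b, g a b‖ ≥ K / ((p : ℝ) * M) ^ m * J := by
    rw [Finset.sum_congr rfl fun a ha => hfib a (Finset.mem_filter.1 ha).2, Finset.sum_const,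
      nsmul_eq_mul, norm_mul, Complex.norm_natCast, Complex.norm_real, Real.norm_eq_abs,
      abs_of_pos hJ0]
    gcongr
  have hsecond : ‖∑ a with ¬ tupleSum a = y, ∑ b, g a b‖ ≤ K * (J * (1 / (2 * N * δ)) ^ p) := by
    refine (norm_sum_le _ _).trans ((Finset.sum_le_sum fun a ha =>
      hoff a (Finset.mem_filter.1 ha).2).trans ?_)
    rw [Finset.sum_const, nsmul_eq_mul]
    have h4 : ((Finset.univ.filter fun a : Fin p × Fin m → Fin M =>
        ¬ tupleSum a = y).card : ℝ) ≤ K := by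
      rw [hK]
      exact_mod_cast Finset.card_le_univ _
    gcongr
  have htri : ‖∑ a with tupleSum a = y, ∑ b, g a b‖
      ≤ ‖∑ a, ∑ b, g a b‖ + ‖∑ a with ¬ tupleSum a = y, ∑ b, g a b‖ := by
    rw [← hsplit]
    exact norm_le_add_norm_add _ _
  have hfin : K * J * (1 / ((p : ℝ) * M) ^ m)
      ≤ K * J * ((1 / (2 * N * δ)) ^ p + (1 / (2 * M * ε)) ^ p) := by
    calc K * J * (1 / ((p : ℝ) * M) ^ m) = K / ((p : ℝ) * M) ^ m * J := by ring
      _ ≤ _ := hfirst.le.trans htri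
      _ ≤ J * (K * (1 / (2 * M * ε)) ^ p) + K * (J * (1 / (2 * N * δ)) ^ p) :=
        add_le_add hupper hsecond
      _ = _ := by ring
  exact absurd (le_of_mul_le_mul_left hfin (by positivity)) (not_le.2 hlt)

/-- If the dual system with exponent `w'` is unsolvable for arbitrarily large parameters, then
the inhomogeneous system with any exponent less than `1 / w'` is solvable, possibly with `q = 0`,
for arbitrarily large parameters. -/
theorem frequently_exists_inhomogeneous_approx {m n : ℕ} (X : Matrix (Fin m) (Fin n) ℝ)
    (θ : Fin m → ℝ) {w w' : ℝ} (hw : 0 ≤ w) (hw' : 0 < w') (hww : w * w' < 1)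
    (hdual : ∃ᶠ T : ℝ in atTop, ¬ ApproxSolvable Xᵀ 0 w' T) :
    ∃ᶠ Q : ℝ in atTop, ∃ q : Fin n → ℤ, ‖centredRep (affineForm X θ q)‖ < Q ^ (-w) ∧ ‖q‖ ≤ Q := by
  -- The scales are `Q = T ^ κ`, `δ = T ^ (-w')`, `ε = Q ^ (-w)`. The slack `η` in `κ = w' + η`
  -- makes `N δ` a positive power of `T`, while `κ w < 1` keeps `M ε` one too.
  set η : ℝ := (1 - w * w') / (2 * (w + 1)) with hη
  have hη0 : 0 < η := div_pos (by linarith) (by positivity)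
  set κ := w' + η with hκ
  have hκ0 : 0 < κ := by positivity
  have hκw : κ * w < 1 := by
    have h1 : η * (2 * (w + 1)) = 1 - w * w' := div_mul_cancel₀ _ (by positivity)
    nlinarith
  set σ := min η (1 - κ * w) with hσ
  have hσ0 : 0 < σ := lt_min hη0 (by linarith)
  -- Each exponential sum saves `T ^ σ` up to a constant; `p > m / σ` makes the `p`-th power of the
  -- saving exceed the loss `T ^ m`.
  obtain ⟨p, hp⟩ := exists_nat_gt (m / σ)
  have hpσ : (m : ℝ) < σ * p := by
    rw [div_lt_iff₀ hσ0] at hp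
    linarith
  have hp0 : 0 < p := by
    rcases Nat.eq_zero_or_pos p with h | h
    · rw [h, Nat.cast_zero, mul_zero] at hpσ
      exact absurd hpσ (not_lt.2 (Nat.cast_nonneg m))
    · exact h
  have hp' : (0 : ℝ) < p := by exact_mod_cast hp0
  have hlim : Tendsto (fun T : ℝ => 2 * (p : ℝ) ^ p * T ^ (-(σ * p - m))) atTop (𝓝 0) := by
    simpa using (tendsto_rpow_neg_atTop (sub_pos.2 hpσ)).const_mul (2 * (p : ℝ) ^ p)
  refine (tendsto_rpow_atTop hκ0).frequently
    (p := fun Q : ℝ => ∃ q : Fin n → ℤ, ‖centredRep (affineForm X θ q)‖ < Q ^ (-w) ∧ ‖q‖ ≤ Q) ?_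
  refine (hdual.and_eventually ((hlim.eventually_lt_const one_pos).and
    ((eventually_ge_atTop (max 1 (2 * (p : ℝ)))).and
    ((tendsto_rpow_atTop hκ0).eventually_ge_atTop (2 * (p : ℝ)))))).mono ?_
  rintro T ⟨hT, hT1, hT2, hT3⟩
  have hT0 : 1 ≤ T := (le_max_left _ _).trans hT2
  have hT4 : 2 * (p : ℝ) ≤ T := (le_max_right _ _).trans hT2
  have hTpos : 0 < T := by linarith
  have hfloor : ∀ S : ℝ, 2 * (p : ℝ) ≤ S →
      S / (2 * p) ≤ ⌊S / p⌋₊ ∧ (p : ℝ) * ⌊S / p⌋₊ ≤ S ∧ 0 < ⌊S / p⌋₊ := by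
    intro S hS
    have h1 : 2 ≤ S / p := by rwa [le_div_iff₀ hp']
    have h2 := Nat.lt_floor_add_one (S / p)
    have h3 := Nat.floor_le (show 0 ≤ S / p by linarith)
    refine ⟨?_, ?_, Nat.floor_pos.2 (by linarith)⟩
    · have : S / (2 * p) = S / p / 2 := by rw [div_div, mul_comm]
      linarith
    · rwa [le_div_iff₀ hp', mul_comm] at h3
  obtain ⟨hM1, hM2, hM3⟩ := hfloor T hT4
  obtain ⟨hN1, hN2, hN3⟩ := hfloor (T ^ κ) hT3
  set M := ⌊T / p⌋₊ with hM
  set N := ⌊T ^ κ / p⌋₊ with hN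
  have hTw' : 0 < T ^ (-w') := Real.rpow_pos_of_pos hTpos _
  have hε : 0 < (T ^ κ) ^ (-w) := Real.rpow_pos_of_pos (Real.rpow_pos_of_pos hTpos _) _
  have hMpos : (0 : ℝ) < M := by exact_mod_cast hM3
  have hNpos : (0 : ℝ) < N := by exact_mod_cast hN3
  obtain ⟨q, hq1, hq2⟩ := exists_inhomogeneous_approx X θ hp0 hM3 hN3 hTw' hε (by
    intro y hy hyT
    by_contra! hlt
    exact hT ⟨y, hy, hlt, hyT.trans hM2⟩) (by
    have hb1 : 1 / (2 * N * T ^ (-w')) ≤ p * T ^ (-σ) := by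
      have h1 : T ^ κ / p * T ^ (-w') ≤ 2 * N * T ^ (-w') := by
        gcongr
        have : T ^ κ / (2 * p) * 2 = T ^ κ / p := by field_simp
        linarith
      have h2 : T ^ κ / p * T ^ (-w') = T ^ η / p := by
        rw [div_mul_eq_mul_div, ← Real.rpow_add hTpos]
        congr 2
        rw [hκ]; ring
      rw [h2] at h1
      have h3 : 0 < T ^ η / p := div_pos (Real.rpow_pos_of_pos hTpos _) hp'
      refine (one_div_le_one_div_of_le h3 h1).trans ?_
      rw [one_div_div, div_eq_mul_inv, ← Real.rpow_neg hTpos.le]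
      gcongr
      exact min_le_left _ _
    have hb2 : 1 / (2 * M * (T ^ κ) ^ (-w)) ≤ p * T ^ (-σ) := by
      have h1 : T / p * (T ^ κ) ^ (-w) ≤ 2 * M * (T ^ κ) ^ (-w) := by
        gcongr
        have : T / (2 * p) * 2 = T / p := by field_simp
        linarith
      have h2 : T / p * (T ^ κ) ^ (-w) = T ^ (1 - κ * w) / p := by
        rw [div_mul_eq_mul_div, ← Real.rpow_mul hTpos.le, ← Real.rpow_one_add' hTpos.le]
        · congr 2
          ring
        · linarith
      rw [h2] at h1
      have h3 : 0 < T ^ (1 - κ * w) / p := div_pos (Real.rpow_pos_of_pos hTpos _) hp'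
      refine (one_div_le_one_div_of_le h3 h1).trans ?_
      rw [one_div_div, div_eq_mul_inv, ← Real.rpow_neg hTpos.le]
      gcongr
      exact min_le_right _ _
    have hb3 : (p * T ^ (-σ)) ^ p = (p : ℝ) ^ p * T ^ (-(σ * p)) := by
      rw [mul_pow, ← Real.rpow_mul_natCast hTpos.le]
      congr 2
      ring
    have hb4 : 1 / T ^ m ≤ 1 / ((p : ℝ) * M) ^ m := by
      gcongr
    refine lt_of_lt_of_le ?_ hb4
    refine (add_le_add (pow_le_pow_left₀ (by positivity) hb1 p)
      (pow_le_pow_left₀ (by positivity) hb2 p)).trans_lt ?_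
    rw [hb3, ← two_mul, lt_div_iff₀ (by positivity)]
    refine lt_of_le_of_lt (le_of_eq ?_) hT1
    rw [← Real.rpow_natCast T m, neg_sub, sub_eq_neg_add, Real.rpow_add hTpos]
    ring)
  exact ⟨q, hq1, hq2.trans hN2⟩

/-! ### Exponents as suprema, and their elementary properties. -/

theorem EReal.coe_le_of_forall_lt_of_nonneg {r : ℝ} {e : EReal} (he : 0 ≤ e)
    (h : ∀ w : ℝ, 0 ≤ w → w < r → (w : EReal) ≤ e) : (r : EReal) ≤ e := by
  by_contra! hlt
  obtain ⟨w, hw1, hw2⟩ := EReal.lt_iff_exists_real_btwn.1 hlt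
  have hw0 : 0 ≤ w := by exact_mod_cast (he.trans hw1.le)
  exact absurd (h w hw0 (by exact_mod_cast hw2)) (not_le.2 hw1)

theorem EReal.le_coe_of_forall_pos_lt {c : ℝ} {e : EReal} (hc : 0 ≤ c)
    (h : ∀ w : ℝ, 0 < w → (w : EReal) < e → w ≤ c) : e ≤ (c : EReal) := by
  by_contra! hlt
  obtain ⟨w, hw1, hw2⟩ := EReal.lt_iff_exists_real_btwn.1 hlt
  have hw0 : c < w := by exact_mod_cast hw1
  exact absurd (h w (by linarith) hw2) (not_le.2 hw0)

theorem norm_centredRep_le {m : ℕ} (y : Fin m → ℝ) : ‖centredRep y‖ ≤ 1 / 2 := by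
  rw [pi_norm_le_iff_of_nonneg (by norm_num)]
  exact fun j => abs_sub_round (y j)

theorem exists_norm_le_abs_apply {m : ℕ} {y : Fin m → ℝ} (hy : 0 < ‖y‖) : ∃ j, ‖y‖ ≤ |y j| := by
  by_contra! h
  exact lt_irrefl _ ((pi_norm_lt_iff hy).2 h)

theorem norm_intCast_pi {m : ℕ} (y : Fin m → ℤ) : ‖fun j => (y j : ℝ)‖ = ‖y‖ := by
  have h : ∀ j, ‖(y j : ℝ)‖₊ = ‖y j‖₊ := fun j => NNReal.eq (Int.norm_cast_real (y j))
  simp only [Pi.norm_def, h]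

section Exponents

variable {m n : ℕ} {X : Matrix (Fin m) (Fin n) ℝ} {θ : Fin m → ℝ}

theorem le_omegaExp {w : ℝ} (hw : 0 ≤ w) (h : ∃ᶠ Q : ℝ in atTop, ApproxSolvable X θ w Q) :
    (w : EReal) ≤ omegaExp X θ :=
  le_sSup ⟨w, rfl, hw, h⟩

theorem le_omegaHat {w : ℝ} (hw : 0 ≤ w) (h : ∀ᶠ Q : ℝ in atTop, ApproxSolvable X θ w Q) :
    (w : EReal) ≤ omegaHat X θ :=
  le_sSup ⟨w, rfl, hw, h⟩

theorem ApproxSolvable.mono {w w' Q : ℝ} (hQ : 1 ≤ Q) (hw : w ≤ w')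
    (h : ApproxSolvable X θ w' Q) : ApproxSolvable X θ w Q := by
  obtain ⟨q, hq0, hq1, hq2⟩ := h
  exact ⟨q, hq0, hq1.trans_le (Real.rpow_le_rpow_of_exponent_le hQ (by linarith)), hq2⟩

theorem eventually_approxSolvable_of_lt_omegaHat {w : ℝ} (h : (w : EReal) < omegaHat X θ) :
    ∀ᶠ Q : ℝ in atTop, ApproxSolvable X θ w Q := by
  obtain ⟨_, ⟨w', rfl, _, hev⟩, hlt⟩ := lt_sSup_iff.1 h
  filter_upwards [hev, eventually_ge_atTop 1] with Q hQ hQ1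
  exact hQ.mono hQ1 (by exact_mod_cast hlt.le)

theorem approxSolvable_zero (hn : 1 ≤ n) {Q : ℝ} (hQ : 1 ≤ Q) : ApproxSolvable X θ 0 Q := by
  refine ⟨fun _ => 1, fun h => ?_, ?_, ?_⟩
  · exact one_ne_zero (congrFun h ⟨0, hn⟩)
  · rw [neg_zero, Real.rpow_zero]
    exact (norm_centredRep_le _).trans_lt (by norm_num)
  · rw [pi_norm_le_iff_of_nonneg (by linarith)]
    intro i
    simpa using hQ

theorem omegaExp_nonneg (hn : 1 ≤ n) : 0 ≤ omegaExp X θ := by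
  have h : ∃ᶠ Q : ℝ in atTop, ApproxSolvable X θ 0 Q :=
    ((eventually_ge_atTop 1).mono fun Q hQ => approxSolvable_zero hn hQ).frequently
  exact_mod_cast le_omegaExp le_rfl h

theorem omegaHat_nonneg (hn : 1 ≤ n) : 0 ≤ omegaHat X θ := by
  have h : ∀ᶠ Q : ℝ in atTop, ApproxSolvable X θ 0 Q :=
    (eventually_ge_atTop 1).mono fun Q hQ => approxSolvable_zero hn hQ
  exact_mod_cast le_omegaHat le_rfl h

/-- A cube of side `Q ^ (-w)` lies in the corresponding hyperbolic region, and the same holds for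
the bound on `q`. -/
theorem omegaExp_le_omegaMul (hm : 1 ≤ m) : omegaExp X θ ≤ omegaMul X θ := by
  refine sSup_le_sSup ?_
  rintro _ ⟨w, rfl, hw, hfr⟩
  refine ⟨w, rfl, hw, (hfr.and_eventually (eventually_ge_atTop 1)).mono ?_⟩
  rintro Q ⟨⟨q, hq0, hq1, hq2⟩, hQ⟩
  refine ⟨q, hq0, ?_, ?_⟩
  · calc ∏ j, |centredRep (affineForm X θ q) j|
        ≤ ∏ _j : Fin m, ‖centredRep (affineForm X θ q)‖ :=
          Finset.prod_le_prod (fun _ _ => abs_nonneg _) fun j _ =>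
            norm_le_pi_norm (centredRep (affineForm X θ q)) j
      _ = ‖centredRep (affineForm X θ q)‖ ^ m := by simp
      _ < (Q ^ (-w)) ^ m := pow_lt_pow_left₀ hq1 (norm_nonneg _) (by omega)
      _ = Q ^ (-((m : ℝ) * w)) := by
          rw [← Real.rpow_mul_natCast (by linarith)]
          congr 1
          ring
  · calc ∏ i, max 1 |(q i : ℝ)| ≤ ∏ _i : Fin n, Q := by
          refine Finset.prod_le_prod (fun _ _ => by positivity) fun i _ => max_le hQ ?_
          have := (norm_le_pi_norm q i).trans hq2
          rwa [Int.norm_eq_abs] at this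
      _ = Q ^ n := by simp

/-! ### Homogeneous transference: from uniform approximation of the transpose to approximation of
`X`. -/

/-- Dirichlet's theorem. -/
theorem eventually_approxSolvable_of_mul_lt (X : Matrix (Fin m) (Fin n) ℝ) {w : ℝ} (hw : 0 ≤ w)
    (h : m * w < n) : ∀ᶠ Q : ℝ in atTop, ApproxSolvable X 0 w Q := by
  filter_upwards [eventually_ge_atTop 1,
    (tendsto_rpow_atTop (sub_pos.2 h)).eventually_gt_atTop (((n : ℝ) + m + 1) ^ (n + m))]
    with Q hQ1 hQ2
  have hQ : 0 < Q := by linarith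
  -- With no orthogonality constraints the only minor is the empty determinant 1. The strict
  -- inequality `m w < n` absorbs the dimensional constant.
  refine exists_approx_of_minors X (k := 0) (fun a => a.elim0) (Δ := 1) hQ
    (Real.rpow_pos_of_pos hQ _) (Real.rpow_le_one_of_one_le_of_nonpos hQ1 (by linarith))
    (fun f => by simp) ⟨fun a => a.elim0, by simp⟩ ?_
  rw [one_mul, ← Real.rpow_natCast Q n, ← Real.rpow_mul_natCast hQ.le, ← Real.rpow_add hQ]
  refine hQ2.trans_le (le_of_eq ?_)
  congr 1
  ring

theorem div_le_omegaExp (hm : 1 ≤ m) (hn : 1 ≤ n) (X : Matrix (Fin m) (Fin n) ℝ) :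
    ((n / m : ℝ) : EReal) ≤ omegaExp X 0 :=
  EReal.coe_le_of_forall_lt_of_nonneg (omegaExp_nonneg hn) fun w hw hlt =>
    le_omegaExp hw (eventually_approxSolvable_of_mul_lt X hw (by
      rwa [lt_div_iff₀' (by exact_mod_cast hm)] at hlt)).frequently

theorem div_le_omegaHat (hm : 1 ≤ m) (hn : 1 ≤ n) (X : Matrix (Fin m) (Fin n) ℝ) :
    ((n / m : ℝ) : EReal) ≤ omegaHat X 0 :=
  EReal.coe_le_of_forall_lt_of_nonneg (omegaHat_nonneg hn) fun w hw hlt =>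
    le_omegaHat hw (eventually_approxSolvable_of_mul_lt X hw (by
      rwa [lt_div_iff₀' (by exact_mod_cast hm)] at hlt))

/-- If `ᵗX y` is an integer vector, then `X` is approximable like an `(m - 1) × n` matrix. -/
theorem eventually_approxSolvable_of_centredRep_eq_zero (X : Matrix (Fin m) (Fin n) ℝ)
    {y : Fin m → ℤ} (hy : y ≠ 0) (hy0 : centredRep (affineForm Xᵀ 0 y) = 0) {w : ℝ} (hw : 0 ≤ w)
    (h : (m - 1) * w < n) : ∀ᶠ Q : ℝ in atTop, ApproxSolvable X 0 w Q := by
  filter_upwards [eventually_ge_atTop 1, (tendsto_rpow_atTop (sub_pos.2 h)).eventually_gt_atTop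
    (‖y‖ * ((n : ℝ) + m + 1) ^ (n + m))] with Q hQ1 hQ2
  have hQ : 0 < Q := by linarith
  have hε : 0 < Q ^ (-w) := Real.rpow_pos_of_pos hQ _
  obtain ⟨j, hj⟩ : ∃ j, y j ≠ 0 := Function.ne_iff.1 hy
  -- One constraint: the row is `(0, ε y)`, so its minors carry a factor `ε`, which lowers the
  -- effective number of forms from `m` to `m - 1`.
  refine exists_approx_of_minors X (fun _ : Fin 1 => y) (Δ := Q ^ (-w) * ‖y‖) hQ hε
    (Real.rpow_le_one_of_one_le_of_nonpos hQ1 (by linarith)) (fun f => ?_)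
    ⟨fun _ => Sum.inr j, ?_⟩ ?_
  · rw [Matrix.det_fin_one, Matrix.of_apply]
    rcases f 0 with i | i
    · rw [Sum.elim_inl, hy0, Pi.zero_apply, mul_zero, abs_zero]
      positivity
    · rw [Sum.elim_inr, abs_mul, abs_of_pos hε, ← Int.norm_eq_abs]
      exact mul_le_mul_of_nonneg_left (norm_le_pi_norm y i) hε.le
  · rw [Matrix.det_fin_one, Matrix.of_apply, Sum.elim_inr]
    exact mul_ne_zero hε.ne' (by exact_mod_cast hj)
  · calc Q ^ (-w) * ‖y‖ * ((n : ℝ) + m + 1) ^ (n + m)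
        = Q ^ (-w) * (‖y‖ * ((n : ℝ) + m + 1) ^ (n + m)) := by ring
      _ < Q ^ (-w) * Q ^ (n - (m - 1) * w) := mul_lt_mul_of_pos_left hQ2 hε
      _ = Q ^ n * (Q ^ (-w)) ^ m := by
        rw [← Real.rpow_natCast Q n, ← Real.rpow_mul_natCast hQ.le, ← Real.rpow_add hQ,
          ← Real.rpow_add hQ]
        congr 1
        ring

/-- Two consecutive minimal points of a uniformly approximable matrix. -/
theorem exists_consecutive_minimal_points {h : ℝ} (hh : 0 < h)
    (hnd : ∀ y : Fin n → ℤ, y ≠ 0 → centredRep (affineForm X 0 y) ≠ 0)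
    (hev : ∀ᶠ T : ℝ in atTop, ApproxSolvable X 0 h T) (T₀ : ℝ) :
    ∃ y₁ y₂ : Fin n → ℤ, T₀ ≤ ‖y₂‖ ∧ ‖y₁‖ < ‖y₂‖ ∧
      ‖centredRep (affineForm X 0 y₂)‖ < ‖centredRep (affineForm X 0 y₁)‖ ∧
      ‖centredRep (affineForm X 0 y₁)‖ ≤ (‖y₂‖ / 2) ^ (-h) := by
  set L : (Fin n → ℤ) → ℝ := fun y => ‖centredRep (affineForm X 0 y)‖ with hL
  have hfin : ∀ S : ℝ, {y : Fin n → ℤ | ‖y‖ ≤ S}.Finite := by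
    intro S
    have h1 := (isCompact_closedBall (0 : Fin n → ℤ) S).finite_of_discrete
    simpa [Metric.closedBall, dist_eq_norm] using h1
  obtain ⟨T₁, hT₁⟩ := eventually_atTop.1 hev
  set S := max T₀ (2 * T₁) with hS
  obtain ⟨y₁, ⟨hy₁0, hy₁S⟩, hmin₁⟩ := Set.exists_min_image {y : Fin n → ℤ | y ≠ 0 ∧ ‖y‖ ≤ max S T₁}
    L ((hfin _).subset fun y hy => hy.2) (by
      obtain ⟨y, hy, -, hyn⟩ := hT₁ (max S T₁) (le_max_right _ _)
      exact ⟨y, hy, hyn⟩)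
  have hL₁ : 0 < L y₁ := norm_pos_iff.2 (hnd y₁ hy₁0)
  obtain ⟨T, hT, hTL⟩ := (hev.and ((tendsto_rpow_neg_atTop hh).eventually_lt_const hL₁)).exists
  obtain ⟨y', hy'0, hy'L, -⟩ := hT
  -- `y₂` is a shortest vector improving on `y₁`. The auxiliary `y'` shows that there is one, and
  -- restricting to `‖y‖ ≤ ‖y'‖` keeps the search finite.
  obtain ⟨y₂, ⟨⟨hy₂0, hy₂L⟩, hy₂n⟩, hmin₂⟩ := Set.exists_min_image
    {y : Fin n → ℤ | (y ≠ 0 ∧ L y < L y₁) ∧ ‖y‖ ≤ ‖y'‖} (fun y => ‖y‖)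
    ((hfin _).subset fun y hy => hy.2) ⟨y', ⟨hy'0, hy'L.trans hTL⟩, le_rfl⟩
  have hSy : max S T₁ < ‖y₂‖ := by
    by_contra! hle
    exact absurd (hmin₁ y₂ ⟨hy₂0, hle⟩) (not_le.2 hy₂L)
  have hSy' : S < ‖y₂‖ := (le_max_left _ _).trans_lt hSy
  have hpos : 0 < ‖y₂‖ := norm_pos_iff.2 hy₂0
  refine ⟨y₁, y₂, (le_max_left _ _).trans hSy'.le, hy₁S.trans_lt hSy, hy₂L, ?_⟩
  -- A solution at height `‖y₂‖ / 2` is strictly shorter than `y₂`, so it cannot improve on `y₁`.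
  -- The halving is needed because the height bound in `ApproxSolvable` is not strict.
  obtain ⟨y, hy0, hyL, hyn⟩ := hT₁ (‖y₂‖ / 2) (by
    have := (le_max_right T₀ (2 * T₁)).trans_lt hSy'
    linarith)
  refine le_trans ?_ hyL.le
  by_contra! hlt
  have := hmin₂ y ⟨⟨hy0, hlt⟩, by linarith⟩
  linarith

/-- Transference from the uniform exponent of `ᵗX` to the ordinary exponent of `X`. -/
theorem frequently_approxSolvable_of_transpose_uniform (X : Matrix (Fin m) (Fin n) ℝ) {h w : ℝ}
    (hh : 0 < h) (hw : 0 ≤ w)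
    (hnd : ∀ y : Fin m → ℤ, y ≠ 0 → centredRep (affineForm Xᵀ 0 y) ≠ 0)
    (hev : ∀ᶠ T : ℝ in atTop, ApproxSolvable Xᵀ 0 h T)
    (hlt : 2 * (1 - h * w) < (n - m * w) * (1 + h)) :
    ∃ᶠ Q : ℝ in atTop, ApproxSolvable X 0 w Q := by
  -- With `Q = Y ^ a` the two kinds of entries balance: `Q Y ^ (-h)` and `Q ^ (-w) Y` are both `Y ^
  -- (a - h)`. Then `τ` is the exponent by which `Q ^ n ε ^ m` exceeds the square of this size, and
  -- `hlt` says exactly that `τ > 0`.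
  set a := (1 + h) / (1 + w) with ha
  have ha0 : 0 < a := by positivity
  have haw : a * (1 + w) = 1 + h := div_mul_cancel₀ _ (by positivity)
  set τ := n * a - m * (a * w) - 2 * (a - h) with hτ
  have hτ0 : 0 < τ := by
    have h1 : τ * (1 + w) = (n - m * w) * (1 + h) - 2 * (1 - h * w) := by
      rw [← haw, hτ]
      linear_combination (-2 : ℝ) * haw
    by_contra! hle
    nlinarith
  set C := 2 * (2 ^ h) ^ 2 * ((n : ℝ) + m + 1) ^ (n + m) with hC
  rw [frequently_atTop]
  intro Q₀
  obtain ⟨T₀, hT₀⟩ := eventually_atTop.1 ((eventually_ge_atTop (1 : ℝ)).and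
    (((tendsto_rpow_atTop ha0).eventually_ge_atTop Q₀).and
      ((tendsto_rpow_atTop hτ0).eventually_gt_atTop C)))
  obtain ⟨y₁, y₂, hyT, hy12, hL21, hL1⟩ := exists_consecutive_minimal_points hh hnd hev T₀
  obtain ⟨hY1, hYQ, hYC⟩ := hT₀ _ hyT
  set Y := ‖y₂‖ with hY
  have hY0 : 0 < Y := by linarith
  have hQ : 0 < Y ^ a := Real.rpow_pos_of_pos hY0 _
  have hε : 0 < (Y ^ a) ^ (-w) := Real.rpow_pos_of_pos hQ _
  have hQ1 : 1 ≤ Y ^ a := Real.one_le_rpow hY1 ha0.le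
  refine ⟨Y ^ a, hYQ, ?_⟩
  set R := 2 ^ h * Y ^ (a - h) with hR
  have hR0 : 0 < R := by positivity
  have hQL : Y ^ a * (Y / 2) ^ (-h) = R := by
    rw [Real.div_rpow hY0.le (by norm_num), Real.rpow_neg (by norm_num : (0 : ℝ) ≤ 2), div_inv_eq_mul,
      hR, sub_eq_add_neg, Real.rpow_add hY0]
    ring
  have hεY : (Y ^ a) ^ (-w) * Y ≤ R := by
    rw [← Real.rpow_mul hY0.le, ← Real.rpow_add_one hY0.ne', hR]
    have h1 : a * -w + 1 = a - h := by linear_combination -haw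
    rw [h1]
    exact le_mul_of_one_le_left (Real.rpow_nonneg hY0.le _)
      (Real.one_le_rpow (by norm_num) hh.le)
  set y : Fin 2 → Fin m → ℤ := ![y₁, y₂] with hydef
  have hentry : ∀ (b : Fin 2) (l : Fin n ⊕ Fin m),
      |Sum.elim (fun i => Y ^ a * centredRep (affineForm Xᵀ 0 (y b)) i)
        (fun j => (Y ^ a) ^ (-w) * (y b j : ℝ)) l| ≤ R := by
    intro b l
    have hyb : ‖y b‖ ≤ Y ∧ ‖centredRep (affineForm Xᵀ 0 (y b))‖ ≤ (Y / 2) ^ (-h) := by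
      fin_cases b
      · exact ⟨hy12.le, hL1⟩
      · exact ⟨le_rfl, hL21.le.trans hL1⟩
    rcases l with i | j
    · rw [Sum.elim_inl, abs_mul, abs_of_pos hQ, ← hQL]
      exact mul_le_mul_of_nonneg_left ((norm_le_pi_norm _ i).trans hyb.2) hQ.le
    · rw [Sum.elim_inr, abs_mul, abs_of_pos hε, ← Int.norm_eq_abs]
      exact (mul_le_mul_of_nonneg_left ((norm_le_pi_norm _ j).trans hyb.1) hε.le).trans hεY
  -- Columns for a nonzero minor: `i` where the error of `y₁` is largest and `j` where `y₂` is
  -- largest. As `y₁` is shorter and has the larger error, one product of the determinant strictly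
  -- dominates the other.
  obtain ⟨i, hi⟩ := exists_norm_le_abs_apply ((norm_nonneg _).trans_lt hL21)
  obtain ⟨j, hj⟩ := exists_norm_le_abs_apply (y := fun j => (y₂ j : ℝ))
    (by rw [norm_intCast_pi]; exact hY0)
  rw [norm_intCast_pi, ← hY] at hj
  refine exists_approx_of_minors X y (Δ := 2 * R ^ 2) hQ hε
    (Real.rpow_le_one_of_one_le_of_nonpos hQ1 (by linarith)) (fun f => ?_)
    ⟨![Sum.inl i, Sum.inr j], ?_⟩ ?_
  · rw [Matrix.det_fin_two]
    simp only [Matrix.of_apply]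
    refine (abs_sub _ _).trans ?_
    rw [abs_mul, abs_mul, two_mul, sq]
    exact add_le_add (mul_le_mul (hentry _ _) (hentry _ _) (abs_nonneg _) hR0.le)
      (mul_le_mul (hentry _ _) (hentry _ _) (abs_nonneg _) hR0.le)
  · rw [Matrix.det_fin_two]
    simp only [Matrix.of_apply, Matrix.cons_val_zero, Matrix.cons_val_one, Sum.elim_inl,
      Sum.elim_inr, hydef]
    set ℓ₁ := centredRep (affineForm Xᵀ 0 y₁) with hℓ₁
    set ℓ₂ := centredRep (affineForm Xᵀ 0 y₂) with hℓ₂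
    have h1 : |ℓ₂ i * (y₁ j : ℝ)| < |ℓ₁ i * (y₂ j : ℝ)| := by
      rw [abs_mul, abs_mul]
      have h2 : |ℓ₂ i| < |ℓ₁ i| := ((norm_le_pi_norm ℓ₂ i).trans_lt hL21).trans_le hi
      have h3 : |(y₁ j : ℝ)| < |(y₂ j : ℝ)| := by
        rw [← Int.norm_eq_abs]
        exact ((norm_le_pi_norm y₁ j).trans_lt hy12).trans_le hj
      exact mul_lt_mul'' h2 h3 (abs_nonneg _) (abs_nonneg _)
    have h4 : ℓ₁ i * (y₂ j : ℝ) - ℓ₂ i * (y₁ j : ℝ) ≠ 0 := by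
      intro h0
      rw [sub_eq_zero.1 h0] at h1
      exact lt_irrefl _ h1
    have h5 := mul_ne_zero (mul_ne_zero hQ.ne' hε.ne') h4
    intro h0
    apply h5
    rw [← h0]
    ring
  · calc 2 * R ^ 2 * ((n : ℝ) + m + 1) ^ (n + m) = C * (Y ^ (a - h)) ^ 2 := by
          rw [hC, hR]; ring
      _ < Y ^ τ * (Y ^ (a - h)) ^ 2 := by gcongr
      _ = (Y ^ a) ^ n * ((Y ^ a) ^ (-w)) ^ m := by
        rw [← Real.rpow_mul_natCast hY0.le, ← Real.rpow_mul_natCast hY0.le,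
          ← Real.rpow_mul hY0.le, ← Real.rpow_mul_natCast hY0.le, ← Real.rpow_add hY0,
          ← Real.rpow_add hY0]
        congr 1
        rw [hτ]
        push_cast
        ring

/-- If either inequality failed, transference would produce approximations to `X` with an exponent
exceeding `v`. -/
theorem mul_le_of_lt_omegaHat_transpose (hm : 1 ≤ m) (hn : 1 ≤ n) {v : ℝ}
    (hv : omegaExp X 0 = v) {h : ℝ} (hh : 0 < h) (hlt : (h : EReal) < omegaHat Xᵀ 0) :
    (1 ≤ h → h * (n - (m - 1) * v) ≤ 1) ∧ (h ≤ 1 → h * v ≤ m * v - n + 1) := by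
  have hm' : (1 : ℝ) ≤ m := by exact_mod_cast hm
  have hv0 : 0 ≤ v := by
    have h1 : 0 ≤ omegaExp X 0 := omegaExp_nonneg hn
    rw [hv] at h1
    exact_mod_cast h1
  have hmv : (n : ℝ) ≤ m * v := by
    have h1 := div_le_omegaExp hm hn X
    rw [hv, EReal.coe_le_coe_iff, div_le_iff₀ (by linarith)] at h1
    linarith
  have hexp : ∀ w : ℝ, v < w → ¬ ∃ᶠ Q : ℝ in atTop, ApproxSolvable X 0 w Q := by
    intro w hw hfr
    have h1 := le_omegaExp (by linarith) hfr
    rw [hv, EReal.coe_le_coe_iff] at h1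
    linarith
  by_cases hnd : ∀ y : Fin m → ℤ, y ≠ 0 → centredRep (affineForm Xᵀ 0 y) ≠ 0
  · have hstar : (n - m * v) * (1 + h) ≤ 2 * (1 - h * v) := by
      by_contra! hcon
      set g := (n - m * v) * (1 + h) - 2 * (1 - h * v) with hg
      have hg0 : 0 < g := by linarith
      -- Raising `v` by `t` uses up at most half of the gap `g`, so the strict inequality required
      -- for transference persists at `v + t`.
      set t := g / (2 * (m * (1 + h))) with ht
      have ht0 : 0 < t := by positivity
      have ht1 : t * (m * (1 + h)) = g / 2 := by rw [ht]; field_simp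
      refine hexp (v + t) (by linarith) (frequently_approxSolvable_of_transpose_uniform X hh
        (by linarith) hnd (eventually_approxSolvable_of_lt_omegaHat hlt) ?_)
      nlinarith [mul_pos hh ht0]
    constructor
    · intro h1
      nlinarith
    · intro h1
      nlinarith
  · push Not at hnd
    obtain ⟨y, hy, hy0⟩ := hnd
    -- When some nonzero `y` makes `ᵗX y` integral there need be no sequence of minimal points, but
    -- `v` is then so large that both claims are immediate.
    have hdeg : (n : ℝ) ≤ (m - 1) * v := by
      by_contra! hcon
      set t := (n - (m - 1) * v) / (2 * m) with ht
      have ht0 : 0 < t := div_pos (by linarith) (by linarith)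
      have ht1 : t * m = (n - (m - 1) * v) / 2 := by rw [ht]; field_simp
      exact hexp (v + t) (by linarith) (eventually_approxSolvable_of_centredRep_eq_zero X hy hy0
        (by linarith) (by nlinarith)).frequently
    constructor <;> intro h1 <;> nlinarith

theorem omegaExp_eq_of_centredRep_eq_zero (hθ : centredRep θ = 0) :
    omegaExp X θ = omegaExp X 0 := by
  have h1 : ∀ q : Fin n → ℤ, centredRep (affineForm X θ q) = centredRep (affineForm X 0 q) := by
    intro q
    ext j
    have h2 : θ j = (round (θ j) : ℝ) := sub_eq_zero.1 (congrFun hθ j)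
    simp only [centredRep, affineForm, Pi.add_apply, Pi.zero_apply, add_zero]
    rw [h2, round_add_intCast]
    push_cast
    ring
  simp only [omegaExp, ApproxSolvable, h1]

/-! ### Lower bounds for inhomogeneous exponents. -/

/-- The inhomogeneous exponent is at least the reciprocal of the uniform exponent of `ᵗX`. -/
theorem le_omegaExp_of_omegaHat_transpose_le (hn : 1 ≤ n) {r : ℝ} (hr : 0 < r)
    (hhat : omegaHat Xᵀ 0 ≤ (1 / r : ℝ)) (hr0 : (r : EReal) ≤ omegaExp X 0) (θ : Fin m → ℝ) :
    (r : EReal) ≤ omegaExp X θ := by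
  refine EReal.coe_le_of_forall_lt_of_nonneg (omegaExp_nonneg hn) fun w hw hwr => ?_
  rcases hw.eq_or_lt with rfl | hw0
  · exact omegaExp_nonneg hn
  -- The Kronecker-type result may return `q = 0`. For integral `θ` the homogeneous exponent is used
  -- instead; otherwise `q = 0` has a fixed positive error and is excluded for large `Q`.
  by_cases hθ : centredRep θ = 0
  · rw [omegaExp_eq_of_centredRep_eq_zero hθ]
    exact (EReal.coe_le_coe_iff.2 hwr.le).trans hr0
  -- The reciprocal of the mean of `w` and `r` lies strictly between `1 / r` and `1 / w`: above the
  -- uniform exponent, yet still admissible for transference.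
  have hw' : 1 / r < 2 / (w + r) := by
    rw [div_lt_div_iff₀ hr (by positivity)]
    linarith
  have hww : w * (2 / (w + r)) < 1 := by
    rw [← mul_div_assoc, div_lt_one (by positivity)]
    linarith
  have hdual : ∃ᶠ T : ℝ in atTop, ¬ ApproxSolvable Xᵀ 0 (2 / (w + r)) T := by
    intro hev
    simp only [not_not] at hev
    have h1 := (le_omegaHat (by positivity) hev).trans hhat
    rw [EReal.coe_le_coe_iff] at h1
    linarith
  refine le_omegaExp hw (((frequently_exists_inhomogeneous_approx X θ hw (by positivity) hww
    hdual).and_eventually ((tendsto_rpow_neg_atTop hw0).eventually_lt_const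
      (norm_pos_iff.2 hθ))).mono ?_)
  rintro Q ⟨⟨q, hq1, hq2⟩, hQ⟩
  refine ⟨q, ?_, hq1, hq2⟩
  rintro rfl
  have h1 : affineForm X θ 0 = θ := by
    ext j
    simp [affineForm, Matrix.mulVec, dotProduct]
  rw [h1] at hq1
  linarith

/-- The lower bounds for the inhomogeneous exponent, for an individual matrix. -/
theorem omegaExp_inhomogeneous_lower_bound (hm : 1 ≤ m) (hn : 1 ≤ n) {v : ℝ}
    (hv : omegaExp X 0 = v) (θ : Fin m → ℝ) :
    (n : ℝ) ≤ m * v ∧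
    (omegaHat Xᵀ 0 ≤ 1 → ((v / (m * v - n + 1) : ℝ) : EReal) ≤ omegaExp X θ) ∧
    (1 ≤ omegaHat Xᵀ 0 → ((n - (m - 1) * v : ℝ) : EReal) ≤ omegaExp X θ) ∧
    (n ≤ m → 1 ≤ omegaHat Xᵀ 0) := by
  have hm' : (1 : ℝ) ≤ m := by exact_mod_cast hm
  have hn' : (1 : ℝ) ≤ n := by exact_mod_cast hn
  have hmv : (n : ℝ) ≤ m * v := by
    have h1 := div_le_omegaExp hm hn X
    rw [hv, EReal.coe_le_coe_iff, div_le_iff₀ (by linarith)] at h1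
    linarith
  have hv0 : 0 < v := by
    by_contra! hle
    nlinarith
  have hbelow : ∀ h : ℝ, 0 < h → (h : EReal) < omegaHat Xᵀ 0 → h ≤ 1 → h * v ≤ m * v - n + 1 :=
    fun h hh hlt => (mul_le_of_lt_omegaHat_transpose hm hn hv hh hlt).2
  refine ⟨hmv, fun hhat => ?_, fun hhat => ?_, fun hnm => ?_⟩
  · have hD : 0 < m * v - n + 1 := by linarith
    refine le_omegaExp_of_omegaHat_transpose_le hn (div_pos hv0 hD) ?_ ?_ θ
    · rw [one_div_div]
      refine EReal.le_coe_of_forall_pos_lt (by positivity) fun h hh hlt => ?_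
      rw [le_div_iff₀ hv0]
      exact hbelow h hh hlt (by exact_mod_cast (hlt.trans_le hhat).le)
    · rw [hv, EReal.coe_le_coe_iff]
      exact div_le_self hv0.le (by linarith)
  · rcases le_or_gt (n - (m - 1) * v) 0 with hr | hr
    · exact (EReal.coe_le_coe_iff.2 hr).trans (omegaExp_nonneg hn)
    -- Letting `h` tend to 1 from below in `hbelow` gives `v ≤ m v - n + 1`. This covers the values
    -- `h < 1` in the bound on `ω̂(ᵗX)` below.
    have hr1 : n - (m - 1) * v ≤ 1 := by
      have h1 : v ≤ m * v - n + 1 := by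
        by_contra! hcon
        have hD : 0 < m * v - n + 1 := by linarith
        set h := (1 + (m * v - n + 1) / v) / 2 with hh
        have h2 : (m * v - n + 1) / v < 1 := by rwa [div_lt_one hv0]
        have h3 : 0 < (m * v - n + 1) / v := div_pos hD hv0
        have h4 : h < 1 := by linarith
        have h5 := hbelow h (by linarith)
          (lt_of_lt_of_le (by exact_mod_cast h4) hhat) h4.le
        rw [← le_div_iff₀ hv0] at h5
        linarith
      linarith
    refine le_omegaExp_of_omegaHat_transpose_le hn hr ?_ ?_ θ
    · refine EReal.le_coe_of_forall_pos_lt (by positivity) fun h hh hlt => ?_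
      rw [le_div_iff₀ hr]
      rcases le_total 1 h with h1 | h1
      · exact (mul_le_of_lt_omegaHat_transpose hm hn hv hh hlt).1 h1
      · nlinarith
    · rw [hv, EReal.coe_le_coe_iff]
      linarith
  · refine le_trans ?_ (div_le_omegaHat hn hm Xᵀ)
    have h1 : (1 : ℝ) ≤ m / n := by
      rw [le_div_iff₀ (by linarith), one_mul]
      exact_mod_cast hnm
    exact_mod_cast h1

/-- The lower bound for the multiplicative inhomogeneous exponent, for an individual matrix. -/
theorem omegaMul_inhomogeneous_lower_bound (hm : 1 ≤ m) (hn : 1 ≤ n) {v : ℝ}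
    (hv : omegaMul X 0 = v) (θ : Fin m → ℝ) :
    ((max 0 ((n - (m - 1) * v) / (m * v - n + 1)) : ℝ) : EReal) ≤ omegaMul X θ := by
  have hle : omegaExp X 0 ≤ v := hv ▸ omegaExp_le_omegaMul hm
  obtain ⟨u, hu⟩ : ∃ u : ℝ, omegaExp X 0 = u := by
    refine ⟨(omegaExp X 0).toReal, (EReal.coe_toReal ?_ ?_).symm⟩
    · exact ne_top_of_le_ne_top (EReal.coe_ne_top v) hle
    · exact ne_bot_of_le_ne_bot EReal.zero_ne_bot (omegaExp_nonneg hn)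
  have huv : u ≤ v := by rw [hu] at hle; exact_mod_cast hle
  obtain ⟨hmu, hA, hB, -⟩ := omegaExp_inhomogeneous_lower_bound hm hn hu θ
  refine le_trans ?_ (omegaExp_le_omegaMul hm)
  have hm' : (1 : ℝ) ≤ m := by exact_mod_cast hm
  have hD : 1 ≤ m * u - n + 1 := by linarith
  have hDD : m * u - n + 1 ≤ m * v - n + 1 := by nlinarith
  rcases le_or_gt (n - (m - 1) * v) 0 with hr | hr
  · rw [max_eq_left (div_nonpos_of_nonpos_of_nonneg hr (by linarith))]
    exact omegaExp_nonneg hn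
  rw [max_eq_right (div_nonneg hr.le (by linarith))]
  have hnum : n - (m - 1) * v ≤ n - (m - 1) * u := by nlinarith
  -- In the first case `n ≤ m u` gives `n - (m - 1) v ≤ n - (m - 1) u ≤ u`, so numerators and
  -- denominators compare separately. In the second the denominator is at least 1 and can be
  -- dropped.
  rcases le_total (omegaHat Xᵀ 0) 1 with hhat | hhat
  · refine le_trans (EReal.coe_le_coe_iff.2 ?_) (hA hhat)
    exact div_le_div₀ (by linarith) (by linarith) (by linarith) hDD
  · refine le_trans (EReal.coe_le_coe_iff.2 ?_) (hB hhat)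
    exact (div_le_self hr.le (by linarith)).trans hnum

end Exponents

theorem mainTheorem5 (m n : ℕ) (hm : 1 ≤ m) (hn : 1 ≤ n)
    (μ : Measure (Matrix (Fin m) (Fin n) ℝ)) :
    (∀ v : ℝ, IsContractingAE μ → (∀ᵐ X ∂μ, omegaExp X 0 = (v : EReal)) →
      ∀ θ : Fin m → ℝ, ∀ᵐ X ∂μ,
        (omegaHat Xᵀ 0 ≤ 1 → ((v / (m * v - n + 1) : ℝ) : EReal) ≤ omegaExp X θ) ∧
        (1 ≤ omegaHat Xᵀ 0 → ((n - (m - 1) * v : ℝ) : EReal) ≤ omegaExp X θ) ∧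
        (n ≤ m → 1 ≤ omegaHat Xᵀ 0)) ∧
    (∀ v : ℝ, IsStronglyContractingAE μ → (∀ᵐ X ∂μ, omegaMul X 0 = (v : EReal)) →
      ∀ θ : Fin m → ℝ, ∀ᵐ X ∂μ,
        ((max 0 ((n - (m - 1) * v) / (m * v - n + 1)) : ℝ) : EReal) ≤ omegaMul X θ) := by
  refine ⟨fun v _ hv θ => ?_, fun v _ hv θ => ?_⟩
  · filter_upwards [hv] with X hX
    exact (omegaExp_inhomogeneous_lower_bound hm hn hX θ).2
  · filter_upwards [hv] with X hX
    exact omegaMul_inhomogeneous_lower_bound hm hn hX θ
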